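/- Let $P$ be an ordered set (that is, a partially ordered set) with a least element $0$ and a greatest element $1$. For a lattice $K$ and $a, b \in K$, let $\mathrm{con}(a,b)$ denote the principal congruence generated by $(a,b)$, i.e., the smallest lattice congruence of $K$ that identifies $a$ and $b$, and let $\mathrm{Princ}\,K = \{\mathrm{con}(a,b) : a, b \in K\}$, ordered by inclusion. Then there is a bounded lattice $K$ such that $P \cong \mathrm{Princ}\,K$ as ordered sets. If $P$ is finite, then $K$ can be chosen to be finite. -/

import Mathlib

universe u

namespace LatticeCon

variable {L : Type u} [Lattice L]

theorem toSetoid_injective :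
    Function.Injective (LatticeCon.toSetoid : LatticeCon L → Setoid L) := by
  rintro ⟨s, _, _⟩ ⟨t, _, _⟩ h
  cases h
  rfl

/-- Congruences of a lattice, ordered by inclusion (as sets of pairs). -/
instance instPartialOrder : PartialOrder (LatticeCon L) :=
  PartialOrder.lift LatticeCon.toSetoid toSetoid_injective

theorem le_iff {c d : LatticeCon L} : c ≤ d ↔ ∀ x y : L, c.r x y → d.r x y :=
  ⟨fun h _ _ hxy => h hxy, fun h _ _ hxy => h _ _ hxy⟩

/-- The principal congruence `con(a, b)`: the smallest congruence of `L` that collapses `a`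
and `b`, i.e. the intersection of all congruences that collapse them. -/
def principal (a b : L) : LatticeCon L where
  r x y := ∀ c : LatticeCon L, c.r a b → c.r x y
  iseqv :=
    { refl := fun x c _ => c.iseqv.refl x
      symm := fun h c hc => c.iseqv.symm (h c hc)
      trans := fun h₁ h₂ c hc => c.iseqv.trans (h₁ c hc) (h₂ c hc) }
  inf h₁ h₂ := fun c hc => c.inf (h₁ c hc) (h₂ c hc)
  sup h₁ h₂ := fun c hc => c.sup (h₁ c hc) (h₂ c hc)

theorem isLeast_principal (a b : L) : IsLeast {c : LatticeCon L | c.r a b} (principal a b) :=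
  ⟨fun _ hc => hc, fun c hc => le_iff.2 fun _ _ h => h c hc⟩

/-- `Princ L`: the set of principal congruences of the lattice `L`. As a subset of the
congruences of `L` it is ordered by inclusion. -/
def Princ (L : Type u) [Lattice L] : Set (LatticeCon L) :=
  {c | ∃ a b : L, c = principal a b}

end LatticeCon

/-! Take `T = P \ {0, 1}`. A flag labels a finite chain of `T ⊕ {three incomparable points}`
antitonically by 0 and 1, with 1 allowed only on `T`; joins that leave the chains become `⊤`.

If a congruence identifies elements with different domains, it collapses some atom `low q` to `⊥`.
With two further atoms this gives a copy of M₃, which is simple and contains `⊥` and `⊤`, so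
everything collapses (`r_bot_top`). If the domains agree, the sets of ones are nested. For distinct
flags, let `t` be the largest place where they differ: meeting with `high t` yields the pair `low t,
high t`, and joining that pair with the smaller flag returns the given pair (`exists_sup_high`).
Collapsing at `t` forces collapsing exactly at all `s ≤ t`. The principal congruences are thus the
identity, one for each `t`, and the full one, ordered as `P`. -/

open Set

/-- The disjoint union of `T` with a three-element antichain. -/
abbrev Node (T : Type u) := T ⊕ (Unit ⊕ Unit ⊕ Unit)

/-- `dom` is a finite chain, and `up` is a lower segment of `dom` that avoids the antichain. -/
structure IsFlag {T : Type u} [PartialOrder T] (dom up : Set (Node T)) : Prop where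
  finite : dom.Finite
  total : ∀ a ∈ dom, ∀ b ∈ dom, a ≤ b ∨ b ≤ a
  subset : up ⊆ dom
  inl_of_mem : ∀ a ∈ up, ∃ t, a = Sum.inl t
  lower : ∀ a ∈ dom, ∀ b ∈ up, a ≤ b → a ∈ up

/-- The lattice of flags with a top element `(univ, univ)` adjoined. A flag is a function from a
finite chain to `{0, 1}` which is antitone: `dom` is its domain, and `up` its set of ones. -/
@[ext]
structure FlagLattice (T : Type u) [PartialOrder T] where
  dom : Set (Node T)
  up : Set (Node T)
  cond : (dom = univ ∧ up = univ) ∨ IsFlag dom up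

namespace FlagLattice

variable {T : Type u} [PartialOrder T]

theorem exists_not_comparable (q : Node T) : ∃ r s : Node T,
    ¬ (q ≤ r ∨ r ≤ q) ∧ ¬ (q ≤ s ∨ s ≤ q) ∧ ¬ (r ≤ s ∨ s ≤ r) := by
  rcases q with t | ⟨⟩ | ⟨⟩ | ⟨⟩
  · exact ⟨.inr (.inl ()), .inr (.inr (.inl ())), by simp, by simp, by simp⟩
  · exact ⟨.inr (.inr (.inl ())), .inr (.inr (.inr ())), by simp, by simp, by simp⟩
  · exact ⟨.inr (.inl ()), .inr (.inr (.inr ())), by simp, by simp, by simp⟩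
  · exact ⟨.inr (.inl ()), .inr (.inr (.inl ())), by simp, by simp, by simp⟩

theorem not_total_univ : ¬ ∀ a ∈ (univ : Set (Node T)), ∀ b ∈ (univ : Set (Node T)),
    a ≤ b ∨ b ≤ a := fun h =>
  let ⟨r, _, hr, _⟩ := exists_not_comparable (.inr (.inl ()) : Node T)
  hr (h _ trivial r trivial)

instance : Top (FlagLattice T) := ⟨⟨univ, univ, .inl ⟨rfl, rfl⟩⟩⟩

instance : Bot (FlagLattice T) :=
  ⟨⟨∅, ∅, .inr ⟨finite_empty, by simp, by simp, by simp, by simp⟩⟩⟩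

instance : PartialOrder (FlagLattice T) where
  le x y := x.dom ⊆ y.dom ∧ x.up ⊆ y.up
  le_refl _ := ⟨Subset.rfl, Subset.rfl⟩
  le_trans _ _ _ h₁ h₂ := ⟨h₁.1.trans h₂.1, h₁.2.trans h₂.2⟩
  le_antisymm _ _ h₁ h₂ := FlagLattice.ext (h₁.1.antisymm h₂.1) (h₁.2.antisymm h₂.2)

@[simp] theorem dom_bot : (⊥ : FlagLattice T).dom = ∅ := rfl
@[simp] theorem up_bot : (⊥ : FlagLattice T).up = ∅ := rfl

theorem isFlag {x : FlagLattice T} (h : ∀ a ∈ x.dom, ∀ b ∈ x.dom, a ≤ b ∨ b ≤ a) :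
    IsFlag x.dom x.up :=
  x.cond.resolve_left fun h' => not_total_univ (h'.1 ▸ h)

theorem up_subset_dom (x : FlagLattice T) : x.up ⊆ x.dom := by
  rcases x.cond with h | h
  · simp [h.1]
  · exact h.subset

theorem mem_up_of_le (x : FlagLattice T) {a b : Node T} (ha : a ∈ x.dom) (hb : b ∈ x.up)
    (h : a ≤ b) : a ∈ x.up := by
  rcases x.cond with h' | h'
  · simp [h'.2]
  · exact h'.lower a ha b hb h

/-! ### Lattice operations on flags -/

/-- The union of the domains is a chain. -/
def Compatible (x y : FlagLattice T) : Prop :=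
  ∀ a ∈ x.dom ∪ y.dom, ∀ b ∈ x.dom ∪ y.dom, a ≤ b ∨ b ≤ a

theorem IsFlag.inter {A B A' B' : Set (Node T)} (h : IsFlag A B) (hs : B' ⊆ A')
    (hl : ∀ a ∈ A', ∀ b ∈ B', a ≤ b → a ∈ B') : IsFlag (A ∩ A') (B ∩ B') where
  finite := h.finite.subset inter_subset_left
  total a ha b hb := h.total a ha.1 b hb.1
  subset := inter_subset_inter h.subset hs
  inl_of_mem a ha := h.inl_of_mem a ha.1
  lower a ha b hb hab := ⟨h.lower a ha.1 b hb.1 hab, hl a ha.2 b hb.2 hab⟩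

instance : Min (FlagLattice T) where
  min x y := ⟨x.dom ∩ y.dom, x.up ∩ y.up, by
    rcases x.cond with h | h
    · simpa [h.1, h.2] using y.cond
    · exact .inr (IsFlag.inter h y.up_subset_dom fun a ha b hb => y.mem_up_of_le ha hb)⟩

@[simp] theorem dom_inf (x y : FlagLattice T) : (x ⊓ y).dom = x.dom ∩ y.dom := rfl
@[simp] theorem up_inf (x y : FlagLattice T) : (x ⊓ y).up = x.up ∩ y.up := rfl

/-- The join of two flags whose domains form a chain. -/
def join (x y : FlagLattice T) (h : Compatible x y) : FlagLattice T where
  dom := x.dom ∪ y.dom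
  up := {a | a ∈ x.dom ∪ y.dom ∧ ∃ b ∈ x.up ∪ y.up, a ≤ b}
  cond := by
    have hx : IsFlag x.dom x.up := isFlag fun a ha b hb => h a (.inl ha) b (.inl hb)
    have hy : IsFlag y.dom y.up := isFlag fun a ha b hb => h a (.inr ha) b (.inr hb)
    refine .inr ⟨hx.finite.union hy.finite, h, fun a ha => ha.1, ?_, ?_⟩
    · rintro a ⟨-, b, hb, hab⟩
      obtain ⟨t, rfl⟩ : ∃ t, b = Sum.inl t := hb.elim (hx.inl_of_mem b) (hy.inl_of_mem b)
      rcases a with a | a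
      · exact ⟨a, rfl⟩
      · simp at hab
    · rintro a ha b ⟨-, c, hc, hbc⟩ hab
      exact ⟨ha, c, hc, hab.trans hbc⟩

open Classical in
noncomputable instance : Max (FlagLattice T) where
  max x y := if h : Compatible x y then join x y h else ⊤

theorem sup_of_compatible {x y : FlagLattice T} (h : Compatible x y) : x ⊔ y = join x y h :=
  dif_pos h

theorem sup_of_not_compatible {x y : FlagLattice T} (h : ¬ Compatible x y) : x ⊔ y = ⊤ :=
  dif_neg h

theorem dom_sup {x y : FlagLattice T} (h : Compatible x y) : (x ⊔ y).dom = x.dom ∪ y.dom := by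
  rw [sup_of_compatible h]; rfl

theorem mem_up_sup {x y : FlagLattice T} (h : Compatible x y) {a : Node T} :
    a ∈ (x ⊔ y).up ↔ a ∈ x.dom ∪ y.dom ∧ ∃ b ∈ x.up ∪ y.up, a ≤ b := by
  rw [sup_of_compatible h]; rfl

theorem le_top' (x : FlagLattice T) : x ≤ ⊤ := ⟨subset_univ _, subset_univ _⟩

noncomputable instance : Lattice (FlagLattice T) where
  inf := (· ⊓ ·)
  sup := (· ⊔ ·)
  inf_le_left _ _ := ⟨inter_subset_left, inter_subset_left⟩
  inf_le_right _ _ := ⟨inter_subset_right, inter_subset_right⟩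
  le_inf _ _ _ h₁ h₂ := ⟨subset_inter h₁.1 h₂.1, subset_inter h₁.2 h₂.2⟩
  le_sup_left x y := by
    by_cases h : Compatible x y
    · refine ⟨(dom_sup h).symm ▸ subset_union_left, fun a ha => (mem_up_sup h).2 ?_⟩
      exact ⟨.inl (x.up_subset_dom ha), a, .inl ha, le_rfl⟩
    · rw [sup_of_not_compatible h]; exact le_top' x
  le_sup_right x y := by
    by_cases h : Compatible x y
    · refine ⟨(dom_sup h).symm ▸ subset_union_right, fun a ha => (mem_up_sup h).2 ?_⟩
      exact ⟨.inr (y.up_subset_dom ha), a, .inr ha, le_rfl⟩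
    · rw [sup_of_not_compatible h]; exact le_top' y
  sup_le x y z hx hy := by
    have hd : x.dom ∪ y.dom ⊆ z.dom := union_subset hx.1 hy.1
    by_cases h : Compatible x y
    · refine ⟨(dom_sup h).symm ▸ hd, fun a ha => ?_⟩
      obtain ⟨ha, b, hb, hab⟩ := (mem_up_sup h).1 ha
      exact z.mem_up_of_le (hd ha) (union_subset hx.2 hy.2 hb) hab
    · rcases z.cond with hz | hz
      · exact ⟨hz.1 ▸ subset_univ _, hz.2 ▸ subset_univ _⟩
      · exact (h fun a ha b hb => hz.total a (hd ha) b (hd hb)).elim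

instance : BoundedOrder (FlagLattice T) where
  le_top := le_top'
  bot_le _ := ⟨empty_subset _, empty_subset _⟩

instance [Finite T] : Finite (FlagLattice T) :=
  Finite.of_injective (fun x : FlagLattice T => (x.dom, x.up)) fun x y h => by
    simp only [Prod.mk.injEq] at h
    exact FlagLattice.ext h.1 h.2

/-! ### Congruences attached to lower sets -/

/-- The flag with domain `{q}` and value `0`. -/
def low (q : Node T) : FlagLattice T :=
  ⟨{q}, ∅, .inr ⟨finite_singleton q, by simp, by simp, by simp, by simp⟩⟩

/-- The flag with domain `{t}` and value `1`. -/
def high (t : T) : FlagLattice T :=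
  ⟨{.inl t}, {.inl t}, .inr ⟨finite_singleton _, by simp, by simp, by simp, by simp⟩⟩

@[simp] theorem dom_low (q : Node T) : (low q).dom = {q} := rfl
@[simp] theorem up_low (q : Node T) : (low q).up = ∅ := rfl
@[simp] theorem dom_high (t : T) : (high t).dom = {.inl t} := rfl
@[simp] theorem up_high (t : T) : (high t).up = {.inl t} := rfl

/-- The congruence that collapses the values of flags on a lower set. -/
def lowerCon (I : LowerSet T) : LatticeCon (FlagLattice T) where
  r x y := x.dom = y.dom ∧ ∀ a : Node T, (∀ t ∈ I, a ≠ .inl t) → (a ∈ x.up ↔ a ∈ y.up)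
  iseqv :=
    { refl := fun _ => ⟨rfl, fun _ _ => Iff.rfl⟩
      symm := fun h => ⟨h.1.symm, fun a ha => (h.2 a ha).symm⟩
      trans := fun h₁ h₂ => ⟨h₁.1.trans h₂.1, fun a ha => (h₁.2 a ha).trans (h₂.2 a ha)⟩ }
  inf h₁ h₂ := ⟨by simp [h₁.1, h₂.1], fun a ha => and_congr (h₁.2 a ha) (h₂.2 a ha)⟩
  sup {w x y z} h₁ h₂ := by
    have hc : Compatible w y ↔ Compatible x z := by simp only [Compatible, h₁.1, h₂.1]
    by_cases h : Compatible w y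
    · refine ⟨by rw [dom_sup h, dom_sup (hc.1 h), h₁.1, h₂.1], fun a ha => ?_⟩
      rw [mem_up_sup h, mem_up_sup (hc.1 h), h₁.1, h₂.1]
      refine and_congr_right fun _ => exists_congr fun b => and_congr_left fun hab => ?_
      -- A one at `a` outside `I` can only come from a `b ≥ a`, which lies outside `I` as well
      -- because `I` is a lower set.
      have hb : ∀ t ∈ I, b ≠ .inl t := by
        rintro t ht rfl
        rcases a with s | i
        · exact ha s (I.lower (Sum.inl_le_inl_iff.1 hab) ht) rfl
        · simp at hab
      exact or_congr (h₁.2 b hb) (h₂.2 b hb)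
    · rw [sup_of_not_compatible h, sup_of_not_compatible (mt hc.2 h)]
      exact ⟨rfl, fun _ _ => Iff.rfl⟩

theorem lowerCon_low_high {I : LowerSet T} {t : T} :
    (lowerCon I).r (low (.inl t)) (high t) ↔ t ∈ I := by
  refine ⟨fun h => ?_, fun h => ⟨rfl, fun a ha => ?_⟩⟩
  · by_contra ht
    have := h.2 (.inl t) fun s hs e => ht (Sum.inl_injective e ▸ hs)
    simp at this
  · simpa using ha t h

theorem lowerCon_bot_top (I : LowerSet T) : ¬ (lowerCon I).r (⊥ : FlagLattice T) ⊤ := fun h =>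
  (h.1 ▸ mem_univ (.inr (.inl ()) : Node T) : (.inr (.inl ()) : Node T) ∈ (⊥ : FlagLattice T).dom)

/-! ### Consequences of collapsing a pair -/

theorem low_sup_low {q r : Node T} (h : ¬ (q ≤ r ∨ r ≤ q)) : low q ⊔ low r = ⊤ :=
  sup_of_not_compatible fun hc => h (hc q (by simp) r (by simp))

theorem low_inf_low {q r : Node T} (h : ¬ (q ≤ r ∨ r ≤ q)) : low q ⊓ low r = ⊥ := by
  have : q ≠ r := by rintro rfl; exact h (.inl le_rfl)
  ext a <;> simp
  rintro rfl; exact this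

theorem inf_low_of_mem {x : FlagLattice T} {q : Node T} (h : q ∈ x.dom) : x ⊓ low q = low q :=
  inf_eq_right.2 ⟨by simpa using h, by simp⟩

theorem inf_low_of_notMem {x : FlagLattice T} {q : Node T} (h : q ∉ x.dom) :
    x ⊓ low q = ⊥ := by
  ext a <;> simp
  rintro ha rfl; exact h ha

theorem inf_high_of_mem {x : FlagLattice T} {t : T} (h : .inl t ∈ x.up) :
    x ⊓ high t = high t :=
  inf_eq_right.2 ⟨by simpa using x.up_subset_dom h, by simpa using h⟩

theorem inf_high_of_notMem {x : FlagLattice T} {t : T} (hd : .inl t ∈ x.dom)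
    (h : .inl t ∉ x.up) : x ⊓ high t = low (.inl t) := by
  ext a
  · simp only [dom_inf, dom_high, dom_low, mem_inter_iff, mem_singleton_iff]
    exact ⟨And.right, fun e => ⟨e ▸ hd, e⟩⟩
  · simp only [up_inf, up_high, up_low, mem_inter_iff, mem_singleton_iff, mem_empty_iff_false,
      iff_false]
    rintro ⟨ha, rfl⟩; exact h ha

/-- Meeting with `low q` collapses that atom. The antichain supplies `r`, `s` such that `low q`,
`low r`, `low s` are the atoms of an M₃. -/
theorem r_bot_top_of_mem_of_notMem (c : LatticeCon (FlagLattice T)) {x y : FlagLattice T}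
    (h : c.r x y) {q : Node T} (hx : q ∈ x.dom) (hy : q ∉ y.dom) : c.r ⊥ ⊤ := by
  have h₀ : c.r (low q) ⊥ := by
    simpa only [inf_low_of_mem hx, inf_low_of_notMem hy] using c.inf h (c.iseqv.refl (low q))
  obtain ⟨r, s, hqr, hqs, hrs⟩ := exists_not_comparable q
  have h₁ : c.r ⊤ (low r) := by
    simpa only [low_sup_low hqr, bot_sup_eq] using c.sup h₀ (c.iseqv.refl (low r))
  have h₂ : c.r ⊤ (low s) := by
    simpa only [low_sup_low hqs, bot_sup_eq] using c.sup h₀ (c.iseqv.refl (low s))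
  have h₃ : c.r (low s) ⊥ := by
    simpa only [top_inf_eq, low_inf_low hrs] using c.inf h₁ (c.iseqv.refl (low s))
  exact c.iseqv.symm (c.iseqv.trans h₂ h₃)

theorem r_bot_top (c : LatticeCon (FlagLattice T)) {x y : FlagLattice T}
    (h : c.r x y) (hd : x.dom ≠ y.dom) : c.r ⊥ ⊤ := by
  by_contra hc
  refine hd (Subset.antisymm (fun q hq => ?_) fun q hq => ?_) <;> by_contra hq'
  · exact hc (r_bot_top_of_mem_of_notMem c h hq hq')
  · exact hc (r_bot_top_of_mem_of_notMem c (c.iseqv.symm h) hq hq')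

theorem r_of_r_bot_top {L : Type u} [Lattice L] [BoundedOrder L] (c : LatticeCon L)
    (h : c.r ⊥ ⊤) (x y : L) : c.r x y := by
  have key : ∀ z : L, c.r ⊥ z := fun z => by
    simpa using c.inf h (c.iseqv.refl z)
  exact c.iseqv.trans (c.iseqv.symm (key x)) (key y)

theorem r_low_high (c : LatticeCon (FlagLattice T)) {x y : FlagLattice T} (h : c.r x y)
    (hd : x.dom = y.dom) {t : T} (hx : .inl t ∉ x.up) (hy : .inl t ∈ y.up) :
    c.r (low (.inl t)) (high t) := by
  have ht : (.inl t : Node T) ∈ x.dom := hd ▸ y.up_subset_dom hy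
  simpa only [inf_high_of_notMem ht hx, inf_high_of_mem hy] using
    c.inf h (c.iseqv.refl (high t))

/-- After joining with `low s`, antitonicity forces value 1 at `s` when `t` has value 1, while
joining to `low t` leaves 0 there. -/
theorem r_low_high_of_le (c : LatticeCon (FlagLattice T)) {s t : T} (hst : s ≤ t)
    (h : c.r (low (.inl t)) (high t)) : c.r (low (.inl s)) (high s) := by
  have hst' : (.inl s : Node T) ≤ .inl t := Sum.inl_le_inl_iff.2 hst
  have h₁ : Compatible (low (.inl t)) (low (.inl s)) := by
    rintro a (rfl | rfl) b (rfl | rfl) <;> simp [hst']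
  -- Compatibility sees only domains, and `low t`, `high t` share theirs.
  have h₂ : Compatible (high t) (low (.inl s)) := h₁
  refine r_low_high c (c.sup h (c.iseqv.refl (low (.inl s)))) ?_ ?_ ?_
  · rw [dom_sup h₁, dom_sup h₂]; rfl
  · simp [mem_up_sup h₁]
  · simp [mem_up_sup h₂, hst]

/-- Of two flags with the same domain, the larger arises from the smaller by raising the value at
the largest place where they differ. -/
theorem exists_sup_high {x y : FlagLattice T} (hd : x.dom = y.dom) (hxy : x.up ⊆ y.up)
    (hne : x ≠ y) : ∃ t : T, .inl t ∉ x.up ∧ .inl t ∈ y.up ∧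
      x ⊔ low (.inl t) = x ∧ x ⊔ high t = y := by
  have hy : IsFlag y.dom y.up := by
    refine y.cond.resolve_left fun h => hne ?_
    rcases x.cond with h' | h'
    · exact FlagLattice.ext hd (h'.2.trans h.2.symm)
    · exact (not_total_univ ((hd.trans h.1) ▸ h'.total)).elim
  obtain ⟨b, hby, hbx⟩ : ∃ b ∈ y.up, b ∉ x.up := by
    by_contra! h
    exact hne (FlagLattice.ext hd (Subset.antisymm hxy h))
  -- Finiteness of the chain is needed here. The largest one of `y` is also the largest difference,
  -- since a one of `x` there would force `b ∈ x.up`.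
  obtain ⟨m, hm⟩ := (hy.finite.subset hy.subset).exists_maximal ⟨b, hby⟩
  have hmax : ∀ a ∈ y.up, a ≤ m := fun a ha =>
    (hy.total a (hy.subset ha) m (hy.subset hm.1)).elim id fun h => hm.2 ha h
  obtain ⟨t, rfl⟩ := hy.inl_of_mem m hm.1
  have htd : .inl t ∈ x.dom := hd ▸ hy.subset hm.1
  have hx : .inl t ∉ x.up := fun h => hbx (x.mem_up_of_le (hd ▸ hy.subset hby) h (hmax b hby))
  have hle : high t ≤ y := ⟨by simpa using hy.subset hm.1, by simpa using hm.1⟩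
  have hxle : x ≤ y := ⟨hd.subset, hxy⟩
  refine ⟨t, hx, hm.1, sup_eq_left.2 ⟨by simpa using htd, by simp⟩,
    le_antisymm (sup_le hxle hle) ⟨hd.symm.subset.trans (le_sup_left : x ≤ x ⊔ high t).1, ?_⟩⟩
  intro a ha
  have had : a ∈ (x ⊔ high t).dom :=
    (le_sup_left : x ≤ x ⊔ high t).1 (hd.symm.subset (hy.subset ha))
  have hth : (.inl t : Node T) ∈ (x ⊔ high t).up := (le_sup_right : high t ≤ x ⊔ high t).2 rfl
  exact mem_up_of_le _ had hth (hmax a ha)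

theorem up_total {x y : FlagLattice T} (hd : x.dom = y.dom) : x.up ⊆ y.up ∨ y.up ⊆ x.up := by
  by_contra! h
  obtain ⟨⟨a, hax, hay⟩, b, hby, hbx⟩ := h.imp not_subset.1 not_subset.1
  rcases x.cond with h' | h'
  · exact hbx (h'.2 ▸ trivial)
  · have ha := x.up_subset_dom hax
    have hb : b ∈ x.dom := hd ▸ y.up_subset_dom hby
    rcases h'.total a ha b hb with hab | hab
    · exact hay (y.mem_up_of_le (hd ▸ ha) hby hab)
    · exact hbx (x.mem_up_of_le hb hax hab)

theorem r_of_lowerCon (c : LatticeCon (FlagLattice T)) {I : LowerSet T}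
    (hI : ∀ t ∈ I, c.r (low (.inl t)) (high t)) {x y : FlagLattice T}
    (h : (lowerCon I).r x y) : c.r x y := by
  wlog hxy : x.up ⊆ y.up generalizing x y
  · exact c.iseqv.symm (this ((lowerCon I).iseqv.symm h) ((up_total h.1).resolve_left hxy))
  by_cases hne : x = y
  · exact hne ▸ c.iseqv.refl x
  obtain ⟨t, htx, hty, h₁, h₂⟩ := exists_sup_high h.1 hxy hne
  have ht : t ∈ I := lowerCon_low_high.1 (r_low_high _ h h.1 htx hty)
  simpa only [h₁, h₂] using c.sup (c.iseqv.refl x) (hI t ht)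

theorem principal_low_high (t : T) :
    LatticeCon.principal (low (.inl t)) (high t) = lowerCon (LowerSet.Iic t) := by
  refine le_antisymm ((LatticeCon.isLeast_principal _ _).2 ?_) (LatticeCon.le_iff.2 ?_)
  · exact lowerCon_low_high.2 (LowerSet.mem_Iic_iff.2 le_rfl)
  · intro x y h
    refine r_of_lowerCon _ (fun s hs => ?_) h
    exact r_low_high_of_le _ (LowerSet.mem_Iic_iff.1 hs) (LatticeCon.isLeast_principal _ _).1

theorem principal_self (x : FlagLattice T) : LatticeCon.principal x x = lowerCon ⊥ := by
  refine le_antisymm ((LatticeCon.isLeast_principal _ _).2 ((lowerCon ⊥).iseqv.refl x))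
    (LatticeCon.le_iff.2 fun _ _ h => r_of_lowerCon _ (fun t ht => ?_) h)
  exact (LowerSet.notMem_bot ht).elim

theorem principal_of_dom_ne {x y : FlagLattice T} (h : x.dom ≠ y.dom) :
    LatticeCon.principal x y = LatticeCon.principal ⊥ ⊤ := by
  refine le_antisymm (LatticeCon.le_iff.2 fun a b _ => ?_) ?_
  · exact r_of_r_bot_top _ (LatticeCon.isLeast_principal _ _).1 a b
  · exact (LatticeCon.isLeast_principal _ _).2 (r_bot_top (LatticeCon.principal x y)
      (LatticeCon.isLeast_principal x y).1 h)

theorem principal_comm {L : Type u} [Lattice L] (a b : L) :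
    LatticeCon.principal a b = LatticeCon.principal b a :=
  le_antisymm
    ((LatticeCon.isLeast_principal a b).2
      ((LatticeCon.principal b a).iseqv.symm (LatticeCon.isLeast_principal b a).1))
    ((LatticeCon.isLeast_principal b a).2
      ((LatticeCon.principal a b).iseqv.symm (LatticeCon.isLeast_principal a b).1))

theorem principal_eq (x y : FlagLattice T) :
    LatticeCon.principal x y = LatticeCon.principal ⊥ ⊤ ∨
    LatticeCon.principal x y = lowerCon ⊥ ∨
    ∃ t, LatticeCon.principal x y = lowerCon (LowerSet.Iic t) := by
  by_cases hd : x.dom = y.dom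
  swap
  · exact .inl (principal_of_dom_ne hd)
  by_cases hne : x = y
  · exact .inr (.inl (hne ▸ principal_self x))
  wlog hxy : x.up ⊆ y.up generalizing x y
  · rw [principal_comm]
    exact this y x hd.symm (Ne.symm hne) ((up_total hd).resolve_left hxy)
  obtain ⟨t, htx, hty, h₁, h₂⟩ := exists_sup_high hd hxy hne
  refine .inr (.inr ⟨t, ?_⟩)
  rw [← principal_low_high]
  refine le_antisymm ((LatticeCon.isLeast_principal _ _).2 ?_)
    ((LatticeCon.isLeast_principal _ _).2
      (r_low_high (LatticeCon.principal x y) (LatticeCon.isLeast_principal x y).1 hd htx hty))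
  let c := LatticeCon.principal (low (.inl t)) (high t)
  have := c.sup (c.iseqv.refl x) (LatticeCon.isLeast_principal _ _).1
  rwa [h₁, h₂] at this

end FlagLattice

/-! ### Matching `P` with the principal congruences -/

section Representation

open FlagLattice

variable {P : Type u} [PartialOrder P] [BoundedOrder P]

/-- The elements other than the bounds. -/
abbrev InnerElement (P : Type u) [PartialOrder P] [BoundedOrder P] := {p : P // p ≠ ⊥ ∧ p ≠ ⊤}

/-- The inner elements below `p`. -/
def innerIic (p : P) : LowerSet (InnerElement P) where
  carrier := {t | t.1 ≤ p}
  lower' _ _ h ht := le_trans h ht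

theorem mem_innerIic {p : P} {t : InnerElement P} : t ∈ innerIic p ↔ t.1 ≤ p := Iff.rfl

theorem innerIic_bot : innerIic (⊥ : P) = ⊥ := by
  ext t
  simpa [mem_innerIic] using t.2.1

theorem innerIic_coe (t : InnerElement P) : innerIic t.1 = LowerSet.Iic t := by
  ext s
  simp [mem_innerIic]

open Classical in
/-- The principal congruence that represents `p`. -/
noncomputable def conOf (p : P) : LatticeCon (FlagLattice (InnerElement P)) :=
  -- The top is separate because `lowerCon (innerIic ⊤)` still distinguishes domains.
  if p = ⊤ then LatticeCon.principal ⊥ ⊤ else lowerCon (innerIic p)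

theorem conOf_top : conOf (⊤ : P) = LatticeCon.principal ⊥ ⊤ := if_pos rfl

theorem conOf_of_ne {p : P} (h : p ≠ ⊤) : conOf p = lowerCon (innerIic p) := if_neg h

theorem conOf_inner (t : InnerElement P) : conOf t.1 = lowerCon (LowerSet.Iic t) := by
  rw [conOf_of_ne t.2.2, innerIic_coe]

theorem conOf_bot [Nontrivial P] : conOf (⊥ : P) = lowerCon ⊥ := by
  rw [conOf_of_ne bot_ne_top, innerIic_bot]

theorem conOf_mem_princ [Nontrivial P] (p : P) :
    conOf p ∈ LatticeCon.Princ (FlagLattice (InnerElement P)) := by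
  by_cases hp : p = ⊤
  · exact ⟨⊥, ⊤, by rw [hp, conOf_top]⟩
  by_cases hp' : p = ⊥
  · exact ⟨⊥, ⊥, by rw [hp', conOf_bot, principal_self]⟩
  · exact ⟨_, _, (conOf_inner ⟨p, hp', hp⟩).trans (principal_low_high _).symm⟩

theorem conOf_le_conOf [Nontrivial P] {p q : P} : conOf p ≤ conOf q ↔ p ≤ q := by
  by_cases hq : q = ⊤
  · subst hq
    refine iff_of_true (LatticeCon.le_iff.2 fun x y _ => ?_) le_top
    rw [conOf_top]
    exact r_of_r_bot_top _ (LatticeCon.isLeast_principal _ _).1 x y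
  by_cases hp : p = ⊤
  · subst hp
    rw [top_le_iff, conOf_top, conOf_of_ne hq]
    refine iff_of_false (fun h => lowerCon_bot_top (innerIic q) ?_) hq
    exact LatticeCon.le_iff.1 h _ _ (LatticeCon.isLeast_principal _ _).1
  by_cases hp' : p = ⊥
  · subst hp'
    refine iff_of_true ?_ bot_le
    rw [conOf_bot, ← principal_self ⊥]
    exact (LatticeCon.isLeast_principal _ _).2 ((conOf q).iseqv.refl _)
  · have hpt : conOf p = _ := (conOf_inner ⟨p, hp', hp⟩).trans (principal_low_high _).symm
    rw [hpt, conOf_of_ne hq, ← mem_innerIic (t := ⟨p, hp', hp⟩), ← lowerCon_low_high]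
    exact ⟨fun h => LatticeCon.le_iff.1 h _ _ (LatticeCon.isLeast_principal _ _).1,
      fun h => (LatticeCon.isLeast_principal _ _).2 h⟩

theorem exists_conOf_eq [Nontrivial P] (x y : FlagLattice (InnerElement P)) :
    ∃ p : P, conOf p = LatticeCon.principal x y := by
  rcases principal_eq x y with h | h | ⟨t, h⟩
  · exact ⟨⊤, conOf_top.trans h.symm⟩
  · exact ⟨⊥, conOf_bot.trans h.symm⟩
  · exact ⟨t, (conOf_inner t).trans h.symm⟩

/-- A nontrivial bounded order is isomorphic to the order of principal congruences of the lattice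
of flags over its inner elements. -/
noncomputable def conOfIso [Nontrivial P] : P ≃o LatticeCon.Princ (FlagLattice (InnerElement P)) :=
  RelIso.ofSurjective
    (OrderEmbedding.ofMapLEIff (fun p : P => (⟨conOf p, conOf_mem_princ p⟩ :
      LatticeCon.Princ (FlagLattice (InnerElement P)))) fun _ _ => conOf_le_conOf)
    fun ⟨_, x, y, h⟩ => (exists_conOf_eq x y).imp fun _ hp => Subtype.ext (hp.trans h.symm)

end Representation

theorem theorem1 (P : Type u) [PartialOrder P] [BoundedOrder P] :
    ∃ (K : Type u) (_ : Lattice K) (_ : BoundedOrder K),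
      Nonempty (P ≃o LatticeCon.Princ K) ∧ (Finite P → Finite K) := by
  rcases subsingleton_or_nontrivial P with hP | hP
  -- A flag lattice always has `⊥ ≠ ⊤`, so the case `0 = 1` needs the one-element lattice.
  · refine ⟨PUnit, inferInstance, inferInstance, ⟨?_⟩, fun _ => inferInstance⟩
    have : Subsingleton (LatticeCon.Princ PUnit.{u + 1}) := by
      refine ⟨?_⟩
      rintro ⟨_, a, b, rfl⟩ ⟨_, c, d, rfl⟩
      rfl
    exact
      { toFun := fun _ => ⟨LatticeCon.principal ⊥ ⊥, ⊥, ⊥, rfl⟩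
        invFun := fun _ => ⊥
        left_inv := fun _ => Subsingleton.elim _ _
        right_inv := fun _ => Subsingleton.elim _ _
        map_rel_iff' := iff_of_true (Subsingleton.elim _ _).le (Subsingleton.elim _ _).le }
  · exact ⟨FlagLattice (InnerElement P), inferInstance, inferInstance, ⟨conOfIso⟩,
      fun _ => inferInstance⟩
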